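/- Let $n\ge 3$. Write $\mathbf{Ring}$ for the category of (unital, not necessarily commutative) rings and $\mathbf{cRing}$ for its full subcategory of commutative rings, and regard the Zariski spectrum, with its structure sheaf, as a functor $\operatorname{Spec}$ from $\mathbf{cRing}^{\mathrm{op}}$ to any of the following categories: * $\mathbf{RingedTop}$: topological spaces with a sheaf of commutative rings, a morphism $X\to Y$ being a continuous map $f$ with a morphism $\mathcal O_Y\to f_*\mathcal O_X$ of sheaves of rings; * $\mathbf{RingedLoc}$: locales with a sheaf of commutative rings, with morphisms defined in the same way (a space is regarded as a locale through its frame of opens); * $\mathbf{RingedTopos}$: (Grothendieck) toposes with a commutative ring object, a morphism $X\to Y$ being a geometric morphism $f$ with a morphism $\mathcal O_Y\to f_*\mathcal O_X$ of ring objects, taken up to isomorphism (a ringed locale is regarded as a ringed topos through its topos of sheaves of sets). Let $\mathbf{D}$ be $\mathbf{RingedTopos}$, $\mathbf{RingedTop}$ or $\mathbf{RingedLoc}$, and let $G\colon\mathbf{Ring}^{\mathrm{op}}\to\mathbf{D}$ be any functor whose restriction to $\mathbf{cRing}^{\mathrm{op}}$ is naturally isomorphic to $\operatorname{Spec}\colon\mathbf{cRing}^{\mathrm{op}}\to\mathbf{D}$.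 Then $G(M_n(\mathbb C))$ is an initial object of $\mathbf{D}$. -/

import Mathlib

open AlgebraicGeometry CategoryTheory Opposite MonoidalCategory CartesianMonoidalCategory Limits

universe u

/-- The canonical Grothendieck topology on a frame `L`: a family of opens below `U` covers `U` if
its join is `U`. Sheaves for it are the usual sheaves on the locale `L`. -/
def frameTopology (L : Type u) [Order.Frame L] : GrothendieckTopology L where
  sieves U := {S | U ≤ sSup {V | ∃ f : V ⟶ U, S f}}
  top_mem' U := le_sSup ⟨𝟙 U, trivial⟩
  pullback_stable' U V S f hS := by
    have h : V ≤ V ⊓ sSup {W | ∃ g : W ⟶ U, S g} := le_inf le_rfl (f.le.trans hS)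
    refine h.trans ?_
    rw [inf_sSup_eq]
    refine iSup₂_le fun W hW => ?_
    obtain ⟨g, hg⟩ := hW
    exact le_sSup ⟨homOfLE inf_le_left,
      S.downward_closed hg (homOfLE inf_le_right)⟩
  transitive' U S hS R hR := by
    refine hS.trans (sSup_le ?_)
    rintro V ⟨f, hf⟩
    refine (hR hf).trans (sSup_le ?_)
    rintro W ⟨g, hg⟩
    exact le_sSup ⟨g ≫ f, hg⟩

/-- On the frame of opens of a space, `frameTopology` is the usual topology of open covers. -/
theorem frameTopology_opens (T : Type u) [TopologicalSpace T] :
    frameTopology (TopologicalSpace.Opens T) = Opens.grothendieckTopology T := by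
  ext U S
  change U ≤ sSup {V | ∃ f : V ⟶ U, S f} ↔ ∀ x ∈ U, ∃ (V : _) (f : V ⟶ U), S f ∧ x ∈ V
  constructor
  · intro h x hx
    obtain ⟨V, ⟨f, hf⟩, hxV⟩ := TopologicalSpace.Opens.mem_sSup.1 (h hx)
    exact ⟨V, f, hf, hxV⟩
  · intro h x hx
    obtain ⟨V, f, hf, hxV⟩ := h x hx
    exact TopologicalSpace.Opens.mem_sSup.2 ⟨V, ⟨f, hf⟩, hxV⟩

/-- A ringed locale: a locale with a sheaf of commutative rings on it. -/
structure RingedLocale : Type (u + 1) where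
  carrier : Locale.{u}
  presheaf : carrierᵒᵖ ⥤ CommRingCat.{u}
  isSheaf : Presheaf.IsSheaf (frameTopology carrier) presheaf

/-- The frame map `M → L` underlying a morphism of locales `f : L ⟶ M`, as a functor. -/
abbrev Locale.inverseImage {L M : Locale.{u}} (f : L ⟶ M) : M ⥤ L :=
  Monotone.functor (f := fun U : M => f.unop.hom U) (OrderHomClass.mono f.unop.hom)

namespace RingedLocale

/-- A morphism of ringed locales `X ⟶ Y`: a morphism `f` of locales together with a morphism
`O_Y ⟶ f_* O_X` of sheaves of commutative rings. -/
@[ext]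
structure Hom (X Y : RingedLocale.{u}) : Type u where
  base : X.carrier ⟶ Y.carrier
  c : Y.presheaf ⟶ (Locale.inverseImage base).op ⋙ X.presheaf

instance : Category.{u} RingedLocale.{u} where
  Hom := Hom
  id X := { base := 𝟙 _, c := 𝟙 X.presheaf }
  comp f g :=
    { base := f.base ≫ g.base
      c := g.c ≫ Functor.whiskerLeft (Locale.inverseImage g.base).op f.c }
  id_comp f := by
    refine Hom.ext rfl (heq_of_eq ?_)
    ext U : 2
    exact Category.comp_id _
  comp_id f := by
    refine Hom.ext rfl (heq_of_eq ?_)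
    ext U : 2
    exact Category.id_comp _
  assoc f g h := by
    refine Hom.ext rfl (heq_of_eq ?_)
    ext U : 2
    exact (Category.assoc (h.c.app U) _ _).symm

end RingedLocale

/-- A ringed space, regarded as a ringed locale through its frame of opens. -/
def AlgebraicGeometry.RingedSpace.toRingedLocale :
    AlgebraicGeometry.RingedSpace.{u, u} ⥤ RingedLocale.{u} where
  obj X :=
    { carrier := topToLocale.obj X.carrier
      presheaf := X.presheaf
      isSheaf := by
        have := X.IsSheaf
        have h := frameTopology_opens X.carrier
        change Presheaf.IsSheaf (frameTopology (TopologicalSpace.Opens X.carrier)) X.presheaf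
        rw [h]
        exact this }
  map {X Y} f :=
    { base := topToLocale.map f.hom.base
      c := { app := fun U => f.hom.c.app U
             naturality := fun U V i => f.hom.c.naturality i } }
  map_id X := by
    refine RingedLocale.Hom.ext rfl (heq_of_eq ?_)
    ext U : 2
    exact SheafedSpace.id_hom_c_app X U
  map_comp f g := by
    refine RingedLocale.Hom.ext rfl (heq_of_eq ?_)
    ext U : 2
    exact SheafedSpace.comp_hom_c_app f g U

/-- `E` is equivalent to the category of sheaves of sets on a small site. -/
def IsGrothendieckTopos (E : Type (u + 1)) [Category.{u} E] : Prop :=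
  ∃ (C : Type u) (_ : SmallCategory C) (J : GrothendieckTopology C),
    Nonempty (E ≌ Sheaf J (Type u))

/-- A ringed topos: a (Grothendieck) topos, with chosen finite products, together with a commutative
ring object in it. The braiding is the (unique) one given by the finite products. -/
structure RingedTopos : Type (u + 2) where
  carrier : Type (u + 1)
  [category : Category.{u} carrier]
  [cartesian : CartesianMonoidalCategory carrier]
  [braided : BraidedCategory carrier]
  isTopos : IsGrothendieckTopos carrier
  ring : carrier
  [commRingObj : CommRingObj ring]

namespace RingedTopos

attribute [instance] category cartesian braided commRingObj

open scoped CommRingObj RingObj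

/-- A morphism of ringed toposes `X → Y`: a geometric morphism `f`, that is, an adjunction
`f^* ⊣ f_*` with `f^*` left exact, together with a morphism of ring objects `O_Y ⟶ f_* O_X`.
The ring structure of `f_* O_X` is the one for which the adjunction bijections
`Hom(f^* Z, O_X) ≃ Hom(Z, f_* O_X)` are ring isomorphisms; so the last three fields say that
`O_Y ⟶ f_* O_X` is a homomorphism of rings on generalized elements. -/
structure Mor (X Y : RingedTopos.{u}) : Type (u + 1) where
  direct : X.carrier ⥤ Y.carrier
  inverse : Y.carrier ⥤ X.carrier
  adj : inverse ⊣ direct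
  leftExact : PreservesFiniteLimits inverse
  comap : Y.ring ⟶ direct.obj X.ring
  map_one (Z : Y.carrier) :
    (adj.homEquiv Z X.ring).symm ((1 : Z ⟶ Y.ring) ≫ comap) = 1
  map_add {Z : Y.carrier} (a b : Z ⟶ Y.ring) :
    (adj.homEquiv Z X.ring).symm ((a + b) ≫ comap) =
      (adj.homEquiv Z X.ring).symm (a ≫ comap) + (adj.homEquiv Z X.ring).symm (b ≫ comap)
  map_mul {Z : Y.carrier} (a b : Z ⟶ Y.ring) :
    (adj.homEquiv Z X.ring).symm ((a * b) ≫ comap) =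
      (adj.homEquiv Z X.ring).symm (a ≫ comap) * (adj.homEquiv Z X.ring).symm (b ≫ comap)

namespace Mor

/-- The identity morphism. -/
def id (X : RingedTopos.{u}) : Mor X X where
  direct := 𝟭 _
  inverse := 𝟭 _
  adj := Adjunction.id
  leftExact := inferInstance
  comap := 𝟙 _
  map_one Z := by
    rw [Category.comp_id]
    exact Category.comp_id _
  map_add a b := by
    simp only [Category.comp_id]
    exact (Category.comp_id _).trans
      (congrArg₂ (· + ·) (Category.comp_id a) (Category.comp_id b)).symm
  map_mul a b := by
    simp only [Category.comp_id]
    exact (Category.comp_id _).trans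
      (congrArg₂ (· * ·) (Category.comp_id a) (Category.comp_id b)).symm

theorem comp_aux {X Y Z : RingedTopos.{u}} (f : Mor X Y) (g : Mor Y Z) {W : Z.carrier}
    (a : W ⟶ Z.ring) :
    ((g.adj.comp f.adj).homEquiv W X.ring).symm (a ≫ g.comap ≫ g.direct.map f.comap) =
      (f.adj.homEquiv _ _).symm ((g.adj.homEquiv _ _).symm (a ≫ g.comap) ≫ f.comap) := by
  rw [Adjunction.comp_homEquiv]
  change (f.adj.homEquiv _ _).symm ((g.adj.homEquiv _ _).symm _) = _
  rw [← Category.assoc, Adjunction.homEquiv_naturality_right_symm]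

/-- Composition of morphisms of ringed toposes. -/
def comp {X Y Z : RingedTopos.{u}} (f : Mor X Y) (g : Mor Y Z) : Mor X Z where
  direct := f.direct ⋙ g.direct
  inverse := g.inverse ⋙ f.inverse
  adj := g.adj.comp f.adj
  leftExact :=
    haveI := f.leftExact
    haveI := g.leftExact
    comp_preservesFiniteLimits _ _
  comap := g.comap ≫ g.direct.map f.comap
  map_one W := by
    refine (comp_aux f g 1).trans ?_
    rw [g.map_one, f.map_one]
  map_add a b := by
    refine (comp_aux f g _).trans ?_
    rw [g.map_add, f.map_add]
    exact (congrArg₂ (· + ·) (comp_aux f g a) (comp_aux f g b)).symm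
  map_mul a b := by
    refine (comp_aux f g _).trans ?_
    rw [g.map_mul, f.map_mul]
    exact (congrArg₂ (· * ·) (comp_aux f g a) (comp_aux f g b)).symm

/-- Two morphisms of ringed toposes are isomorphic if there is a natural isomorphism between the
direct image functors (equivalently, between the inverse image functors) that is compatible with
the morphisms of ring objects. -/
def Isomorphic {X Y : RingedTopos.{u}} (f g : Mor X Y) : Prop :=
  ∃ α : f.direct ≅ g.direct, f.comap ≫ α.hom.app X.ring = g.comap

instance setoid (X Y : RingedTopos.{u}) : Setoid (Mor X Y) where
  r := Isomorphic
  iseqv :=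
    { refl f := ⟨Iso.refl _, by simp⟩
      symm := by
        rintro f g ⟨α, h⟩
        exact ⟨α.symm, by simp [← h]⟩
      trans := by
        rintro f g k ⟨α, h⟩ ⟨β, h'⟩
        exact ⟨α ≪≫ β, by simp [← h', ← h]⟩ }

theorem comp_isomorphic {X Y Z : RingedTopos.{u}} {f f' : Mor X Y} {g g' : Mor Y Z}
    (hf : Isomorphic f f') (hg : Isomorphic g g') : Isomorphic (f.comp g) (f'.comp g') := by
  obtain ⟨α, h⟩ := hf
  obtain ⟨β, h'⟩ := hg
  refine ⟨Functor.isoWhiskerRight α g.direct ≪≫ Functor.isoWhiskerLeft f'.direct β, ?_⟩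
  simp [comp, ← h, ← h']

end Mor

/-- The category of ringed toposes. As usual when toposes are treated as a category, morphisms are
geometric morphisms (with a morphism of ring objects) up to isomorphism. -/
instance : Category.{u + 1} RingedTopos.{u} where
  Hom X Y := Quotient (Mor.setoid X Y)
  id X := ⟦Mor.id X⟧
  comp := Quotient.map₂ Mor.comp fun _ _ hf _ _ hg => Mor.comp_isomorphic hf hg
  id_comp := by
    rintro X Y ⟨f⟩
    exact Quotient.sound ⟨f.direct.leftUnitor, by simp [Mor.comp, Mor.id]⟩
  comp_id := by
    rintro X Y ⟨f⟩
    exact Quotient.sound ⟨f.direct.rightUnitor, by simp [Mor.comp, Mor.id]⟩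
  assoc := by
    rintro W X Y Z ⟨f⟩ ⟨g⟩ ⟨h⟩
    exact Quotient.sound ⟨Functor.associator _ _ _, by simp [Mor.comp]⟩

end RingedTopos


/-- The braiding of the cartesian product on sheaves. -/
noncomputable instance (L : Type u) [Order.Frame L] :
    @BraidedCategory (Sheaf (frameTopology L) (Type u)) _
      SemiCartesianMonoidalCategory.toMonoidalCategory :=
  .ofCartesianMonoidalCategory

namespace RingedLocale

/-- The sheaf of sets underlying the structure sheaf of a ringed locale. -/
def valueSheaf (X : RingedLocale.{u}) : Sheaf (frameTopology X.carrier) (Type u) :=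
  ⟨X.presheaf ⋙ forget CommRingCat,
    (Presheaf.isSheaf_iff_isSheaf_forget _ _ (forget CommRingCat)).1 X.isSheaf⟩

instance (X : RingedLocale.{u}) (U : X.carrierᵒᵖ) : CommRing (X.valueSheaf.obj.obj U) :=
  inferInstanceAs (CommRing (X.presheaf.obj U))

/-- The sheaf of rings as a commutative ring object in the topos of sheaves of sets. -/
noncomputable instance (X : RingedLocale.{u}) : CommRingObj X.valueSheaf where
  zero := ⟨{ app U := ↾fun _ => (0 : X.presheaf.obj U)
             naturality U V i := by ext x; exact (map_zero (X.presheaf.map i).hom).symm }⟩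
  add := ⟨{ app U := ↾fun p : X.presheaf.obj U × X.presheaf.obj U => p.1 + p.2
            naturality U V i := by ext p; exact (map_add (X.presheaf.map i).hom p.1 p.2).symm }⟩
  zero_add := by ext U p; exact zero_add (p.2 : X.presheaf.obj U)
  add_zero := by ext U p; exact add_zero (p.1 : X.presheaf.obj U)
  add_assoc := by
    ext U p
    exact add_assoc (p.1.1 : X.presheaf.obj U) (p.1.2 : X.presheaf.obj U) (p.2 : X.presheaf.obj U)
  neg := ⟨{ app U := ↾fun x : X.presheaf.obj U => -x
            naturality U V i := by ext x; exact (map_neg (X.presheaf.map i).hom x).symm }⟩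
  left_neg := by ext U x; exact neg_add_cancel (x : X.presheaf.obj U)
  right_neg := by ext U x; exact add_neg_cancel (x : X.presheaf.obj U)
  add_comm := by
    ext U p
    exact add_comm (p.2 : X.presheaf.obj U) (p.1 : X.presheaf.obj U)
  one := ⟨{ app U := ↾fun _ => (1 : X.presheaf.obj U)
            naturality U V i := by ext x; exact (map_one (X.presheaf.map i).hom).symm }⟩
  mul := ⟨{ app U := ↾fun p : X.presheaf.obj U × X.presheaf.obj U => p.1 * p.2
            naturality U V i := by ext p; exact (map_mul (X.presheaf.map i).hom p.1 p.2).symm }⟩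
  one_mul := by ext U p; exact one_mul (p.2 : X.presheaf.obj U)
  mul_one := by ext U p; exact mul_one (p.1 : X.presheaf.obj U)
  mul_assoc := by
    ext U p
    exact mul_assoc (p.1.1 : X.presheaf.obj U) (p.1.2 : X.presheaf.obj U) (p.2 : X.presheaf.obj U)
  mul_comm := by
    ext U p
    exact mul_comm (p.2 : X.presheaf.obj U) (p.1 : X.presheaf.obj U)
  mul_add := by
    ext U p
    exact mul_add (p.1 : X.presheaf.obj U) (p.2.1 : X.presheaf.obj U) (p.2.2 : X.presheaf.obj U)
  add_mul := by
    ext U p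
    exact add_mul (p.1.1 : X.presheaf.obj U) (p.1.2 : X.presheaf.obj U) (p.2 : X.presheaf.obj U)

open scoped CommRingObj RingObj

section

variable {X : RingedLocale.{u}} {Z : Sheaf (frameTopology X.carrier) (Type u)}
  (a b : Z ⟶ X.valueSheaf) (U : X.carrierᵒᵖ) (z : Z.obj.obj U)

theorem one_app : (1 : Z ⟶ X.valueSheaf).hom.app U z = (1 : X.presheaf.obj U) := rfl

theorem add_app : (a + b).hom.app U z = (a.hom.app U z + b.hom.app U z : X.presheaf.obj U) := rfl

theorem mul_app : (a * b).hom.app U z = (a.hom.app U z * b.hom.app U z : X.presheaf.obj U) := rfl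

end

end RingedLocale

/-- The ringed topos of sheaves on a ringed locale. -/
noncomputable def RingedLocale.toTopos (X : RingedLocale.{u}) : RingedTopos.{u} where
  carrier := Sheaf (frameTopology X.carrier) (Type u)
  isTopos := ⟨X.carrier, inferInstance, frameTopology X.carrier, ⟨CategoryTheory.Equivalence.refl⟩⟩
  ring := X.valueSheaf

theorem Locale.inverseImage_flat {L M : Locale.{u}} (f : L ⟶ M) :
    RepresentablyFlat (Locale.inverseImage f) where
  cofiltered V :=
    { nonempty := ⟨StructuredArrow.mk (Y := (⊤ : M)) (homOfLE (by
        change V ≤ f.unop.hom ⊤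
        rw [map_top]
        exact le_top))⟩
      cone_objs A B := ⟨StructuredArrow.mk (Y := (A.right ⊓ B.right : M)) (homOfLE (by
          change V ≤ f.unop.hom (A.right ⊓ B.right)
          rw [map_inf]
          exact le_inf A.hom.le B.hom.le)),
        StructuredArrow.homMk (homOfLE inf_le_left) (Subsingleton.elim _ _),
        StructuredArrow.homMk (homOfLE inf_le_right) (Subsingleton.elim _ _), trivial⟩
      cone_maps A B g h := ⟨A, 𝟙 A, by
        ext
        exact Subsingleton.elim _ _⟩ }

theorem Locale.inverseImage_continuous {L M : Locale.{u}} (f : L ⟶ M) :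
    Functor.IsContinuous.{u} (Locale.inverseImage f) (frameTopology M) (frameTopology L) := by
  have := Locale.inverseImage_flat f
  refine (Functor.isContinuous_iff_coverPreserving (F := Locale.inverseImage f)).2 ⟨?_⟩
  intro U S hS
  change f.unop.hom U ≤ sSup _
  refine (OrderHomClass.mono f.unop.hom hS).trans ?_
  rw [map_sSup]
  refine sSup_le ?_
  rintro _ ⟨V, ⟨g, hg⟩, rfl⟩
  exact le_sSup ⟨(Locale.inverseImage f).map g, V, g, 𝟙 _, hg, (Category.id_comp _).symm⟩

theorem CategoryTheory.Adjunction.unit_map_homEquiv_symm {E F : Type*} [Category* E] [Category* F]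
    {l : F ⥤ E} {r : E ⥤ F} (adj : l ⊣ r) {Z : F} {W : E} (s : Z ⟶ r.obj W) :
    adj.unit.app Z ≫ r.map ((adj.homEquiv Z W).symm s) = s :=
  (adj.homEquiv_unit _ _ _).symm.trans (Equiv.apply_symm_apply _ _)

open scoped CommRingObj RingObj in
/-- The morphism of ringed toposes of sheaves induced by a morphism of ringed locales. -/
noncomputable def RingedLocale.toMor {X Y : RingedLocale.{u}} (f : X ⟶ Y) :
    RingedTopos.Mor X.toTopos Y.toTopos :=
  haveI := Locale.inverseImage_flat f.base
  haveI := Locale.inverseImage_continuous f.base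
  let adj := (Locale.inverseImage f.base).sheafAdjunctionContinuous (Type u)
    (frameTopology Y.carrier) (frameTopology X.carrier)
  { direct := (Locale.inverseImage f.base).sheafPushforwardContinuous (Type u)
      (frameTopology Y.carrier) (frameTopology X.carrier)
    inverse := (Locale.inverseImage f.base).sheafPullback (Type u)
      (frameTopology Y.carrier) (frameTopology X.carrier)
    adj := adj
    leftExact :=
      Functor.SmallCategories.instPreservesFiniteLimitsSheafSheafPullbackOfRepresentablyFlat _ _ _ _
    comap := ⟨Functor.whiskerRight f.c (forget CommRingCat)⟩
    map_one Z := by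
      refine (Equiv.symm_apply_eq _).2 (Eq.trans ?_ (adj.homEquiv_unit _ _ _).symm)
      refine ObjectProperty.hom_ext _ (NatTrans.ext (funext fun U => ?_))
      ext z
      exact map_one (f.c.app U).hom
    map_add {Z} a b := by
      refine (Equiv.symm_apply_eq _).2 (Eq.trans ?_ (adj.homEquiv_unit _ _ _).symm)
      refine ObjectProperty.hom_ext _ (NatTrans.ext (funext fun U => ?_))
      ext z
      refine (map_add (f.c.app U).hom (show Y.presheaf.obj U from a.hom.app U z)
        (show Y.presheaf.obj U from b.hom.app U z)).trans ?_
      have h (c : Z ⟶ Y.valueSheaf) := congrArg (fun k => k.hom.app U z)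
        (adj.unit_map_homEquiv_symm (W := X.valueSheaf)
          (c ≫ ⟨Functor.whiskerRight f.c (forget CommRingCat)⟩))
      exact (congrArg₂ (fun x y : X.presheaf.obj _ => x + y) (h a) (h b)).symm
    map_mul {Z} a b := by
      refine (Equiv.symm_apply_eq _).2 (Eq.trans ?_ (adj.homEquiv_unit _ _ _).symm)
      refine ObjectProperty.hom_ext _ (NatTrans.ext (funext fun U => ?_))
      ext z
      refine (map_mul (f.c.app U).hom (show Y.presheaf.obj U from a.hom.app U z)
        (show Y.presheaf.obj U from b.hom.app U z)).trans ?_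
      have h (c : Z ⟶ Y.valueSheaf) := congrArg (fun k => k.hom.app U z)
        (adj.unit_map_homEquiv_symm (W := X.valueSheaf)
          (c ≫ ⟨Functor.whiskerRight f.c (forget CommRingCat)⟩))
      exact (congrArg₂ (fun x y : X.presheaf.obj _ => x * y) (h a) (h b)).symm }

/-- A ringed locale, regarded as a ringed topos through its sheaves of sets. -/
noncomputable def RingedLocale.toRingedTopos : RingedLocale.{u} ⥤ RingedTopos.{u} where
  obj X := X.toTopos
  map f := Quotient.mk _ (RingedLocale.toMor f)
  map_id X := Quotient.sound ⟨Iso.refl _, by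
    refine ObjectProperty.hom_ext _ (NatTrans.ext (funext fun U => ?_))
    ext z
    rfl⟩
  map_comp f g := Quotient.sound ⟨Iso.refl _, by
    refine ObjectProperty.hom_ext _ (NatTrans.ext (funext fun U => ?_))
    ext z
    rfl⟩

/-- The Zariski spectrum with its structure sheaf, as a functor to ringed locales. -/
noncomputable def AlgebraicGeometry.Spec.toRingedLocale :
    CommRingCat.{u}ᵒᵖ ⥤ RingedLocale.{u} :=
  Spec.toSheafedSpace ⋙ RingedSpace.toRingedLocale

/-- The Zariski spectrum with its structure sheaf, as a functor to ringed toposes. -/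
noncomputable def AlgebraicGeometry.Spec.toRingedTopos :
    CommRingCat.{u}ᵒᵖ ⥤ RingedTopos.{u} :=
  Spec.toRingedLocale ⋙ RingedLocale.toRingedTopos

/-! A complete orthogonal family of idempotents in `R` amounts to a ring map `ℤ^I → R`, hence gives
a morphism from `G(R)` to `Spec ℤ^I`, whose basic opens at the coordinate idempotents form a
disjoint cover. Their inverse images split `G(R)` into disjoint pieces, one for each idempotent. The
piece attached to an idempotent depends on that element alone, since it is already pulled back from
`Spec ℤ[X]` along `X ↦ p` (`forcesElement_iff`). A point of `G(R)` would therefore select exactly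
one member of every orthogonal triple with sum `1`: a Kochen–Specker coloring. For `n × n` complex
matrices with `n ≥ 3` no coloring exists (`not_isColoring_matrix`).

A topos may be nontrivial without having points, so a noninitial object takes the role of a point.
It can be refined to a noninitial object lying in one piece of each of finitely many given triples,
and an ultrafilter over the finite sets of triples assembles these choices into a coloring
(`isInitial_of_not_isColoring`). Without colorings every object of the topos is thus initial, which
makes the ringed topos itself initial. Ringed spaces and locales reduce to this case by passing to
sheaves: a degenerate sheaf topos forces `⊤ = ⊥` in the frame. -/

/-! ### Kochen–Specker colorings and the integral 3 × 3 case -/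

/-- Three mutually orthogonal elements with sum `1`, in particular idempotents. -/
def OrthogonalTriple {R : Type*} [Ring R] (p q r : R) : Prop :=
  (p * q = 0 ∧ q * p = 0) ∧ (p * r = 0 ∧ r * p = 0) ∧ (q * r = 0 ∧ r * q = 0) ∧ p + q + r = 1

instance {R : Type*} [Ring R] [DecidableEq R] (p q r : R) : Decidable (OrthogonalTriple p q r) :=
  inferInstanceAs (Decidable (_ ∧ _))

/-- Exactly one of three propositions holds. -/
def ExactlyOne (a b c : Prop) : Prop :=
  (a ∨ b ∨ c) ∧ ¬(a ∧ b) ∧ ¬(a ∧ c) ∧ ¬(b ∧ c)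

/-- A Kochen–Specker coloring of the idempotents of a ring. -/
def IsColoring {R : Type*} [Ring R] (v : R → Prop) : Prop :=
  ∀ p q r : R, OrthogonalTriple p q r → ExactlyOne (v p) (v q) (v r)

/-- These 31 triples of oblique projections, with entries in `{-1, 0, 1}`, share enough members that
the resulting propositional constraints are unsatisfiable. Integer entries make orthogonality
decidable. -/
theorem not_isColoring_matrix_fin_three_int (v : Matrix (Fin 3) (Fin 3) ℤ → Prop) :
    ¬ IsColoring v := by
  intro hv
  have h0 := hv !![1, 0, 0; -1, 0, 0; 1, 0, 0]
    !![0, 0, 0; 0, 1, 1; 0, 0, 0]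
    !![0, 0, 0; 1, 0, -1; -1, 0, 1] (by decide)
  have h1 := hv !![1, 0, 0; -1, 0, 0; 1, 0, 0]
    !![0, 0, 0; 1, 1, 0; 0, 0, 0]
    !![0, 0, 0; 0, 0, 0; -1, 0, 1] (by decide)
  have h2 := hv !![1, 0, 0; 0, 0, 0; 0, 0, 0]
    !![0, 0, 0; 0, 1, 0; 0, 0, 0]
    !![0, 0, 0; 0, 0, 0; 0, 0, 1] (by decide)
  have h3 := hv !![0, -1, 1; 0, 0, 0; 0, -1, 1]
    !![1, 1, -1; 0, 0, 0; 0, 0, 0]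
    !![0, 0, 0; 0, 1, 0; 0, 1, 0] (by decide)
  have h4 := hv !![1, 1, 0; 0, 0, 0; 1, 1, 0]
    !![0, -1, 0; 0, 1, 0; 0, -1, 0]
    !![0, 0, 0; 0, 0, 0; -1, 0, 1] (by decide)
  have h5 := hv !![1, 0, 0; -1, 0, 0; 0, 0, 0]
    !![0, 0, 0; 1, 1, 0; 1, 1, 0]
    !![0, 0, 0; 0, 0, 0; -1, -1, 1] (by decide)
  have h6 := hv !![1, 0, 0; 1, 0, 0; 1, 0, 0]
    !![0, 0, 0; -1, 1, 0; -1, 1, 0]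
    !![0, 0, 0; 0, 0, 0; 0, -1, 1] (by decide)
  have h7 := hv !![1, -1, 1; 1, -1, 1; 1, -1, 1]
    !![0, 1, -1; 0, 1, -1; 0, 0, 0]
    !![0, 0, 0; -1, 1, 0; -1, 1, 0] (by decide)
  have h8 := hv !![1, 1, -1; 1, 1, -1; 1, 1, -1]
    !![0, -1, 1; 0, 0, 0; 0, -1, 1]
    !![0, 0, 0; -1, 0, 1; -1, 0, 1] (by decide)
  have h9 := hv !![1, 1, 0; 0, 0, 0; 1, 1, 0]
    !![0, -1, 0; 0, 1, 0; 0, 0, 0]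
    !![0, 0, 0; 0, 0, 0; -1, -1, 1] (by decide)
  have h10 := hv !![0, 0, 1; 0, 0, 0; 0, 0, 1]
    !![1, 1, -1; 0, 0, 0; 0, 0, 0]
    !![0, -1, 0; 0, 1, 0; 0, 0, 0] (by decide)
  have h11 := hv !![1, 0, 0; 0, 0, 0; 0, 0, 0]
    !![0, 0, 0; 0, 1, 0; 0, 1, 0]
    !![0, 0, 0; 0, 0, 0; 0, -1, 1] (by decide)
  have h12 := hv !![1, 0, 0; 0, 0, 0; 0, 0, 0]
    !![0, 0, 0; 0, 0, 1; 0, 0, 1]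
    !![0, 0, 0; 0, 1, -1; 0, 0, 0] (by decide)
  have h13 := hv !![1, 0, -1; 0, 0, 0; 0, 0, 0]
    !![0, 0, 1; 0, 0, -1; 0, 0, 1]
    !![0, 0, 0; 0, 1, 1; 0, 0, 0] (by decide)
  have h14 := hv !![0, 0, 1; 0, 0, 0; 0, 0, 1]
    !![1, 0, -1; -1, 0, 1; 0, 0, 0]
    !![0, 0, 0; 1, 1, -1; 0, 0, 0] (by decide)
  have h15 := hv !![0, 0, 1; 0, 0, -1; 0, 0, 1]
    !![1, 0, -1; -1, 0, 1; 0, 0, 0]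
    !![0, 0, 0; 1, 1, 0; 0, 0, 0] (by decide)
  have h16 := hv !![0, 1, -1; 0, 1, -1; 0, 0, 0]
    !![1, -1, 1; 0, 0, 0; 0, 0, 0]
    !![0, 0, 0; 0, 0, 1; 0, 0, 1] (by decide)
  have h17 := hv !![1, 0, 0; -1, 0, 0; 0, 0, 0]
    !![0, 0, 0; 0, 0, 1; 0, 0, 1]
    !![0, 0, 0; 1, 1, -1; 0, 0, 0] (by decide)
  have h18 := hv !![0, 1, 0; 0, 1, 0; 0, 1, 0]
    !![1, -1, 0; 0, 0, 0; 0, 0, 0]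
    !![0, 0, 0; 0, 0, 0; 0, -1, 1] (by decide)
  have h19 := hv !![1, 0, 0; 1, 0, 0; 0, 0, 0]
    !![0, 0, 0; -1, 1, 0; 0, 0, 0]
    !![0, 0, 0; 0, 0, 0; 0, 0, 1] (by decide)
  have h20 := hv !![0, 1, 0; 0, 1, 0; 0, 1, 0]
    !![0, -1, 1; 0, 0, 0; 0, -1, 1]
    !![1, 0, -1; 0, 0, 0; 0, 0, 0] (by decide)
  have h21 := hv !![0, 0, 1; 0, 0, 1; 0, 0, 1]
    !![0, 1, -1; 0, 1, -1; 0, 0, 0]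
    !![1, -1, 0; 0, 0, 0; 0, 0, 0] (by decide)
  have h22 := hv !![1, 0, 0; 1, 0, 0; 1, 0, 0]
    !![0, 0, 0; -1, 0, 1; -1, 0, 1]
    !![0, 0, 0; 0, 1, -1; 0, 0, 0] (by decide)
  have h23 := hv !![1, 0, 0; 1, 0, 0; 1, 0, 0]
    !![0, 0, 0; -1, 1, 0; 0, 0, 0]
    !![0, 0, 0; 0, 0, 0; -1, 0, 1] (by decide)
  have h24 := hv !![0, 0, 1; 0, 0, 1; 0, 0, 1]
    !![1, 0, -1; 0, 0, 0; 0, 0, 0]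
    !![0, 0, 0; 0, 1, -1; 0, 0, 0] (by decide)
  have h25 := hv !![0, 1, 0; 0, 1, 0; 0, 0, 0]
    !![1, -1, 0; 0, 0, 0; 0, 0, 0]
    !![0, 0, 0; 0, 0, 0; 0, 0, 1] (by decide)
  have h26 := hv !![0, 0, 1; 0, 0, 0; 0, 0, 1]
    !![1, 0, -1; 0, 0, 0; 0, 0, 0]
    !![0, 0, 0; 0, 1, 0; 0, 0, 0] (by decide)
  have h27 := hv !![1, 1, 0; 0, 0, 0; 1, 1, 0]
    !![-1, -1, 1; 1, 1, -1; -1, -1, 1]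
    !![1, 0, -1; -1, 0, 1; 0, 0, 0] (by decide)
  have h28 := hv !![1, 0, 0; 0, 0, 0; 1, 0, 0]
    !![0, 0, 0; -1, 1, 1; 0, 0, 0]
    !![0, 0, 0; 1, 0, -1; -1, 0, 1] (by decide)
  have h29 := hv !![1, 0, 0; 0, 0, 0; 1, 0, 0]
    !![0, 0, 0; 0, 1, 0; 0, 0, 0]
    !![0, 0, 0; 0, 0, 0; -1, 0, 1] (by decide)
  have h30 := hv !![1, 0, 0; 0, 0, 0; 1, 0, 0]
    !![0, 0, 0; 0, 1, 0; 0, 1, 0]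
    !![0, 0, 0; 0, 0, 0; -1, -1, 1] (by decide)
  clear hv
  simp only [ExactlyOne] at *
  grind (splits := 40)

/-! ### Additivity of colorings and passage to larger matrices -/

namespace IsColoring

variable {R : Type*} [Ring R] {v : R → Prop}

theorem not_zero (hv : IsColoring v) : ¬ v 0 := by
  have h := hv 0 0 1 (by simp [OrthogonalTriple])
  exact fun h0 => h.2.1 ⟨h0, h0⟩

theorem one (hv : IsColoring v) : v 1 := by
  have h := hv 0 0 1 (by simp [OrthogonalTriple])
  have h0 := hv.not_zero
  simp only [ExactlyOne] at h
  tauto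

/-- A coloring is additive on orthogonal idempotents. -/
theorem add_iff (hv : IsColoring v) {p q : R} (hp : p * p = p) (hq : q * q = q)
    (hpq : p * q = 0) (hqp : q * p = 0) : (v (p + q) ↔ v p ∨ v q) ∧ ¬(v p ∧ v q) := by
  -- Both triples contain the complement of `p + q`: one splits the remainder as `p, q`, the other
  -- as `p + q, 0`, and `0` is never colored.
  have h := hv p q (1 - (p + q))
    (by simp [OrthogonalTriple, mul_sub, sub_mul, mul_add, add_mul, hp, hq, hpq, hqp])
  have h' := hv (p + q) (1 - (p + q)) 0
    (by simp [OrthogonalTriple, mul_sub, sub_mul, mul_add, add_mul, hp, hq, hpq, hqp])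
  have h0 := hv.not_zero
  simp only [ExactlyOne] at h h'
  tauto

theorem exists_of_sum (hv : IsColoring v) {I : Type*} {e : I → R}
    (he : OrthogonalIdempotents e) (s : Finset I) (hs : v (∑ i ∈ s, e i)) : ∃ i ∈ s, v (e i) := by
  classical
  induction s using Finset.induction_on with
  | empty => exact absurd (by simpa using hs) hv.not_zero
  | insert i s hi ih =>
    rw [Finset.sum_insert hi] at hs
    rcases (hv.add_iff (he.idem i) he.isIdempotentElem_sum
      (he.mul_sum_of_notMem hi) (by
        rw [Finset.sum_mul]
        exact Finset.sum_eq_zero fun j hj => he.ortho (fun h => hi (h ▸ hj)))).1.1 hs with h | h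
    · exact ⟨i, Finset.mem_insert_self _ _, h⟩
    · obtain ⟨j, hj, h⟩ := ih h
      exact ⟨j, Finset.mem_insert_of_mem hj, h⟩

end IsColoring

theorem OrthogonalTriple.idempotent {R : Type*} [Ring R] {p q r : R} (h : OrthogonalTriple p q r) :
    p * p = p ∧ q * q = q ∧ r * r = r := by
  obtain ⟨⟨h1, h2⟩, ⟨h3, h4⟩, ⟨h5, h6⟩, h⟩ := h
  refine ⟨?_, ?_, ?_⟩
  · simpa [mul_add, h1, h3] using congrArg (p * ·) h
  · simpa [mul_add, h2, h5] using congrArg (q * ·) h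
  · simpa [mul_add, h4, h6] using congrArg (r * ·) h

/-- A coloring restricts to a coloring of every corner whose unit is colored. -/
theorem IsColoring.comp {R S : Type*} [Ring R] [Ring S] {v : R → Prop} (hv : IsColoring v)
    (f : S →ₙ+* R) (hf : v (f 1)) : IsColoring fun s => v (f s) := by
  intro p q r h
  obtain ⟨ip, iq, ir⟩ := h.idempotent
  obtain ⟨⟨h1, h2⟩, ⟨h3, h4⟩, ⟨h5, h6⟩, h⟩ := h
  -- Since `f` need not preserve `1`, the images do not form a triple. Additivity applied twice to
  -- `f p + (f q + f r) = f 1`, which is colored, replaces the triple condition.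
  have hqr := hv.add_iff (p := f q) (q := f r) (by rw [← map_mul, iq]) (by rw [← map_mul, ir])
    (by rw [← map_mul, h5, map_zero]) (by rw [← map_mul, h6, map_zero])
  have hp := hv.add_iff (p := f p) (q := f q + f r) (by rw [← map_mul, ip])
    (by rw [← map_add, ← map_mul]; simp [mul_add, add_mul, iq, ir, h5, h6])
    (by rw [← map_add, ← map_mul]; simp [mul_add, h1, h3])
    (by rw [← map_add, ← map_mul]; simp [add_mul, h2, h4])
  rw [← map_add f q r, ← map_add, ← add_assoc, h, map_add] at hp
  simp only [ExactlyOne]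
  tauto

/-- The inclusion of a corner into a matrix ring, given by an injection of the index sets. -/
def Matrix.cornerHom {m n R S : Type*} [Fintype m] [Fintype n] [DecidableEq m] [DecidableEq n]
    [Ring R] [Ring S] (f : R →+* S) (σ : m ↪ n) : Matrix m m R →ₙ+* Matrix n n S where
  toFun p := (1 : Matrix n n S).submatrix id σ * p.map f * (1 : Matrix n n S).submatrix σ id
  map_mul' p q := by
    have h : (1 : Matrix n n S).submatrix σ id * (1 : Matrix n n S).submatrix id σ = 1 := by
      ext i j
      simp [Matrix.mul_apply, Matrix.one_apply, σ.injective.eq_iff]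
    rw [Matrix.map_mul]
    simp only [Matrix.mul_assoc]
    rw [← Matrix.mul_assoc (Matrix.submatrix _ σ id) (Matrix.submatrix _ id σ), h, Matrix.one_mul]
  map_zero' := by simp
  map_add' p q := by
    rw [Matrix.map_add _ (map_add f), Matrix.mul_add, Matrix.add_mul]

theorem Matrix.cornerHom_single {m n R S : Type*} [Fintype m] [Fintype n] [DecidableEq m]
    [DecidableEq n] [Ring R] [Ring S] (f : R →+* S) (σ : m ↪ n) (i : m) :
    cornerHom f σ (Matrix.diagonal (Pi.single i 1)) = Matrix.diagonal (Pi.single (σ i) 1) := by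
  ext j k
  change ((1 : Matrix n n S).submatrix id σ * (Matrix.diagonal (Pi.single i (1 : R))).map f *
    (1 : Matrix n n S).submatrix σ id) j k = _
  rw [Matrix.mul_apply, Finset.sum_eq_single i, Matrix.mul_apply, Finset.sum_eq_single i]
  · by_cases hj : j = σ i <;> by_cases hk : σ i = k <;>
      simp_all [Matrix.one_apply, Matrix.diagonal_apply, eq_comm]
  · intro x _ hx
    simp [hx]
  · simp
  · intro x _ hx
    rw [Matrix.mul_apply, Finset.sum_eq_zero, zero_mul]
    intro y _
    by_cases hy : y = x
    · simp [hy, hx]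
    · simp [hy]
  · simp

/-- The Kochen–Specker theorem for idempotents in complex matrix rings. -/
theorem not_isColoring_matrix {n : ℕ} (hn : 3 ≤ n) (v : Matrix (Fin n) (Fin n) ℂ → Prop) :
    ¬ IsColoring v := by
  intro hv
  -- The diagonal matrix units sum to `1`, so one of them is colored; the 3 × 3 corner is chosen to
  -- contain it.
  have he := (CompleteOrthogonalIdempotents.single (fun _ : Fin n => ℂ)).map
    (Matrix.diagonalRingHom (Fin n) ℂ)
  obtain ⟨i, -, hi⟩ := hv.exists_of_sum he.toOrthogonalIdempotents Finset.univ
    (by rw [he.complete]; exact hv.one)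
  let σ : Fin 3 ↪ Fin n := (Fin.castLEEmb hn).trans (Equiv.swap (Fin.castLE hn 0) i).toEmbedding
  have hσ : σ 0 = i := Equiv.swap_apply_left (Fin.castLE hn 0) i
  let f := Matrix.cornerHom (Int.castRingHom ℂ) σ
  let p : Matrix (Fin 3) (Fin 3) ℤ := Matrix.diagonal (Pi.single 0 1)
  have hp : p * p = p := by decide
  refine not_isColoring_matrix_fin_three_int _ (hv.comp f ?_)
  -- The corner unit is `f p + f (1 - p)`, and `f p` is the colored matrix unit, so the corner unit
  -- is colored.
  have h := (hv.add_iff (p := f p) (q := f (1 - p)) (by rw [← map_mul, hp])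
    (by rw [← map_mul]; simp [mul_sub, sub_mul, hp]) (by rw [← map_mul]; simp [mul_sub, hp])
    (by rw [← map_mul]; simp [sub_mul, hp])).1.2
  rw [← map_add, add_sub_cancel] at h
  refine h (Or.inl ?_)
  rw [Matrix.cornerHom_single, hσ]
  exact hi

/-! ### Sheaves on a frame and disjoint covers -/

section FrameSheaf

variable {L : Type u} [Order.Frame L]

instance : (frameTopology L).Subcanonical :=
  GrothendieckTopology.Subcanonical.of_isSheaf_yoneda_obj _ fun W U S hS x hx => by
    have hUW : U ≤ W := le_trans (show U ≤ sSup {V | ∃ f : V ⟶ U, S f} from hS)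
      (sSup_le fun V ⟨f, hf⟩ => (x f hf).le)
    exact ⟨homOfLE hUW, fun V _ _ => Subsingleton.elim (α := (V ⟶ W)) _ _,
      fun _ _ => Subsingleton.elim (α := (U ⟶ W)) _ _⟩

/-- The empty sieve covers `⊥`, and gluing the empty family gives exactly one section. -/
theorem CategoryTheory.Presheaf.IsSheaf.unique_of_eq_bot {P : Lᵒᵖ ⥤ Type u}
    (hP : Presheaf.IsSheaf (frameTopology L) P) {U : L} (hU : U = ⊥) :
    Nonempty (Unique (P.obj (op U))) := by
  have h := (isSheaf_iff_isSheaf_of_type _ _).1 hP (⊥ : Sieve U)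
    (show U ≤ sSup {V | ∃ f : V ⟶ U, (⊥ : Sieve U) f} from hU ▸ bot_le)
  obtain ⟨t, -, ht⟩ := h (fun _ _ hf => hf.elim) (fun _ _ _ _ _ _ _ hf => hf.elim)
  exact ⟨⟨⟨t⟩, fun s => ht s fun _ _ hf => hf.elim⟩⟩

/-- A sheaf with exactly one section over each member of a disjoint cover has exactly one section
over the union. -/
theorem CategoryTheory.Presheaf.IsSheaf.unique_of_disjoint_cover {P : Lᵒᵖ ⥤ Type u}
    (hP : Presheaf.IsSheaf (frameTopology L) P) {I : Type*} {U : I → L} {W : L}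
    (hle : ∀ i, U i ≤ W) (hcov : W ≤ ⨆ i, U i) (hdisj : ∀ i j, i ≠ j → U i ⊓ U j = ⊥)
    (h : ∀ i, Nonempty (Unique (P.obj (op (U i))))) : Nonempty (Unique (P.obj (op W))) := by
  have hS := (isSheaf_iff_isSheaf_of_type _ _).1 hP
    (Sieve.generate (Presieve.ofArrows U fun i => homOfLE (hle i)))
    (hcov.trans (iSup_le fun i => le_sSup ⟨homOfLE (hle i), U i, 𝟙 _, homOfLE (hle i), .mk i, Category.id_comp _⟩))
  rw [← Presieve.isSheafFor_iff_generate, Presieve.isSheafFor_arrows_iff] at hS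
  have : ∀ i, Unique (P.obj (op (U i))) := fun i => (h i).some
  obtain ⟨t, -, ht⟩ := hS (fun i => default) fun i j Z gi gj _ => by
    by_cases hij : i = j
    · subst hij
      rw [Subsingleton.elim gi gj]
    · have hZ : Z = ⊥ := le_bot_iff.1 (hdisj i j hij ▸ le_inf gi.le gj.le)
      obtain ⟨_⟩ := hP.unique_of_eq_bot hZ
      exact Subsingleton.elim _ _
  exact ⟨⟨⟨t⟩, fun s => ht s fun i => Subsingleton.elim _ _⟩⟩

end FrameSheaf

/-! ### Objects lying over opens, for an adjunction into a cartesian closed category -/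

section Forcing

variable {L : Type u} [Order.Frame L] {E : Type*} [Category.{u} E] [CartesianMonoidalCategory E]
  {l : Sheaf (frameTopology L) (Type u) ⥤ E} {r : E ⥤ Sheaf (frameTopology L) (Type u)}

/-- The subterminal sheaf represented by an element of a frame. -/
abbrev openSheaf (U : L) : Sheaf (frameTopology L) (Type u) := (frameTopology L).yoneda.obj U

/-- An object over `U` and over `V` lies over `U ⊓ V`. -/
theorem forces_inf [PreservesFiniteLimits l] {X : E} {U V : L} (s : X ⟶ l.obj (openSheaf U))
    (t : X ⟶ l.obj (openSheaf V)) : Nonempty (X ⟶ l.obj (openSheaf (U ⊓ V))) := by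
  let _ : l.Monoidal := .ofChosenFiniteProducts l
  let k : openSheaf U ⊗ openSheaf V ⟶ openSheaf (U ⊓ V) :=
    ⟨{ app W := ↾fun x => homOfLE (le_inf (x.1 : unop W ⟶ U).le (x.2 : unop W ⟶ V).le) }⟩
  exact ⟨lift s t ≫ Functor.LaxMonoidal.μ l _ _ ≫ l.map k⟩

variable [MonoidalClosed E]

/-- Maps out of `X × f^* U` correspond to the sections over `U` of a sheaf on `L`. -/
noncomputable def tensorOpenEquiv (adj : l ⊣ r) (X Z : E) (U : L) :
    (X ⊗ l.obj (openSheaf U) ⟶ Z) ≃ (r.obj ((ihom X).obj Z)).obj.obj (op U) :=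
  ((ihom.adjunction X).homEquiv _ _).trans
    ((adj.homEquiv _ _).trans (frameTopology L).yonedaEquiv)

theorem isInitial_iff_unique {E : Type*} [Category* E] (X : E) :
    Nonempty (IsInitial X) ↔ ∀ Z, Nonempty (Unique (X ⟶ Z)) :=
  ⟨fun ⟨h⟩ Z => ⟨⟨⟨h.to Z⟩, fun _ => h.hom_ext _ _⟩⟩,
    fun h => ⟨IsInitial.ofUniqueHom (fun Z => (h Z).some.default)
      fun Z m => (h Z).some.uniq m⟩⟩

/-- Initiality of `X × f^* U` becomes a condition on sections over `U` of the sheaves `f_*(Z^X)`, so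
it can be glued along covers of `U`. -/
theorem isInitial_tensor_iff (adj : l ⊣ r) (X : E) (U : L) :
    Nonempty (IsInitial (X ⊗ l.obj (openSheaf U))) ↔
      ∀ Z, Nonempty (Unique ((r.obj ((ihom X).obj Z)).obj.obj (op U))) := by
  rw [isInitial_iff_unique]
  exact forall_congr' fun Z => (tensorOpenEquiv adj X Z U).uniqueCongr.nonempty_congr

/-- If `s : X ⟶ Y` has a retraction and `Y` is initial, then so is `X`. -/
def isInitialOfRetract {E : Type*} [Category* E] {X Y : E} (hY : IsInitial Y) (s : X ⟶ Y)
    (p : Y ⟶ X) (h : s ≫ p = 𝟙 X) : IsInitial X :=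
  IsInitial.ofUniqueHom (fun Z => s ≫ hY.to Z) fun Z m => by
    rw [← hY.hom_ext (p ≫ m) (hY.to Z), ← Category.assoc, h, Category.id_comp]

/-- The map `s` makes `X` a retract of `X × f^* ⊥`, which is initial because sheaves have one
section over `⊥`. -/
theorem isInitial_of_forces_bot (adj : l ⊣ r) {X : E} (s : X ⟶ l.obj (openSheaf (⊥ : L))) :
    Nonempty (IsInitial X) := by
  obtain ⟨h⟩ := (isInitial_tensor_iff adj X (⊥ : L)).2 fun Z =>
    (r.obj _).property.unique_of_eq_bot rfl
  exact ⟨isInitialOfRetract h (lift (𝟙 X) s) (fst _ _) (lift_fst _ _)⟩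

/-- A noninitial object has, for every disjoint cover of the terminal object, a noninitial
object over it that lies over a member of the cover. -/
theorem exists_forces_of_disjoint_cover (adj : l ⊣ r) [PreservesFiniteLimits l] {I : Type*}
    {U : I → L} (hcov : ⊤ ≤ ⨆ i, U i) (hdisj : ∀ i j, i ≠ j → U i ⊓ U j = ⊥) {X : E}
    (hX : IsEmpty (IsInitial X)) :
    ∃ (i : I) (X' : E), IsEmpty (IsInitial X') ∧ Nonempty (X' ⟶ X) ∧
      Nonempty (X' ⟶ l.obj (openSheaf (U i))) := by
  -- The products `X × f^* U i` are the candidates. If all were initial, gluing would make `X × f^*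
  -- ⊤` initial, and `X` is a retract of it because `f^* ⊤` is terminal.
  by_contra! hcon
  have h (i : I) : Nonempty (IsInitial (X ⊗ l.obj (openSheaf (U i)))) := by
    by_contra hi
    have := hcon i _ (not_nonempty_iff.1 hi) ⟨fst _ _⟩
    exact this.false (snd _ _)
  have htop : Nonempty (IsInitial (X ⊗ l.obj (openSheaf (⊤ : L)))) :=
    (isInitial_tensor_iff adj X (⊤ : L)).2 fun Z =>
      (r.obj _).property.unique_of_disjoint_cover (fun i => le_top) hcov hdisj
        fun i => (isInitial_tensor_iff adj X (U i)).1 (h i) Z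
  have ht : IsTerminal (openSheaf (⊤ : L)) := IsTerminal.ofUniqueHom
    (fun F => ⟨{ app V := ↾fun _ => homOfLE le_top }⟩) fun F m => by
      ext V x
      exact Subsingleton.elim (α := (unop V ⟶ (⊤ : L))) _ _
  have ht' : IsTerminal (l.obj (openSheaf (⊤ : L))) := IsTerminal.isTerminalObj l _ ht
  exact hX.false (isInitialOfRetract htop.some (lift (𝟙 X) (ht'.from X)) (fst _ _)
    (lift_fst _ _))

end Forcing

/-! ### Forcing along morphisms of ringed toposes -/

namespace RingedTopos

theorem nonempty_monoidalClosed (X : RingedTopos.{u}) : Nonempty (MonoidalClosed X.carrier) := by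
  obtain ⟨C, _, J, ⟨e⟩⟩ := X.isTopos
  exact ⟨@cartesianClosedOfEquiv _ _ _ _ _ _ e.symm
    (instMonoidalClosedSheafOfHasSheafifyOfFunctorOpposite J (Type u))⟩

/-- `Forces m U A` says that the object `A` lies over the inverse image of the open `U` under the
morphism `m` into a ringed locale. -/
def Forces {X : RingedTopos.{u}} {L : RingedLocale.{u}} (m : X ⟶ L.toTopos) (U : L.carrier)
    (A : X.carrier) : Prop :=
  Nonempty (A ⟶ (Quotient.out m).inverse.obj (openSheaf U))

namespace Forces

variable {X : RingedTopos.{u}} {L M : RingedLocale.{u}}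

/-- Isomorphic morphisms have isomorphic inverse image functors. -/
theorem inverse_iso {X Y : RingedTopos.{u}} {f g : Mor X Y} (h : Mor.Isomorphic f g) :
    Nonempty (f.inverse ≅ g.inverse) := by
  obtain ⟨α, -⟩ := h
  exact ⟨(f.adj.ofNatIsoRight α).leftAdjointUniq g.adj⟩

/-- Isomorphic representatives have isomorphic inverse images, so the representative picked by
`Quotient.out` is immaterial. -/
theorem mk_iff (f : Mor X L.toTopos) (U : L.carrier) (A : X.carrier) :
    Forces (L := L) (Quotient.mk _ f : X ⟶ L.toTopos) U A ↔
      Nonempty (A ⟶ f.inverse.obj (openSheaf U)) := by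
  obtain ⟨α⟩ := inverse_iso (Quotient.exact (Quotient.out_eq (Quotient.mk _ f : X ⟶ L.toTopos)))
  exact ⟨fun ⟨s⟩ => ⟨s ≫ α.hom.app _⟩, fun ⟨s⟩ => ⟨s ≫ α.inv.app _⟩⟩

theorem precomp {m : X ⟶ L.toTopos} {U : L.carrier} {A B : X.carrier} (h : Forces m U A)
    (s : B ⟶ A) : Forces m U B :=
  h.map fun t => s ≫ t

theorem comp_iff (m : X ⟶ L.toTopos) (g : L ⟶ M) (U : M.carrier) (A : X.carrier) :
    Forces (L := M) (m ≫ RingedLocale.toRingedTopos.map g) U A ↔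
      Forces m ((Locale.inverseImage g.base).obj U) A := by
  obtain ⟨f, rfl⟩ := Quotient.exists_rep m
  let k := RingedLocale.toMor g
  -- By Yoneda and the adjunction, the inverse image of the sheaf of `U` maps to and from the sheaf
  -- of `g⁻¹ U`. Forcing asks only for existence of a map, so these need not be checked to be
  -- inverse.
  let a : k.inverse.obj (openSheaf U) ⟶ openSheaf ((Locale.inverseImage g.base).obj U) :=
    (k.adj.homEquiv _ _).symm ((frameTopology M.carrier).yonedaEquiv.symm (𝟙 _))
  let b : openSheaf ((Locale.inverseImage g.base).obj U) ⟶ k.inverse.obj (openSheaf U) :=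
    (frameTopology L.carrier).yonedaEquiv.symm
      ((frameTopology M.carrier).yonedaEquiv (k.adj.unit.app (openSheaf U)))
  refine (mk_iff (f.comp k) U A).trans (Iff.trans ?_ (mk_iff f _ A).symm)
  exact ⟨fun ⟨s⟩ => ⟨s ≫ f.inverse.map a⟩, fun ⟨s⟩ => ⟨s ≫ f.inverse.map b⟩⟩

theorem disjoint {m : X ⟶ L.toTopos} {U V : L.carrier} (hUV : U ⊓ V = ⊥) {A : X.carrier}
    (hU : Forces m U A) (hV : Forces m V A) : Nonempty (IsInitial A) := by
  obtain ⟨_⟩ := X.nonempty_monoidalClosed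
  let l : Sheaf (frameTopology L.carrier) (Type u) ⥤ X.carrier := (Quotient.out m).inverse
  have : PreservesFiniteLimits l := (Quotient.out m).leftExact
  obtain ⟨s⟩ := hU
  obtain ⟨t⟩ := hV
  obtain ⟨w⟩ := forces_inf (l := l) s t
  rw [hUV] at w
  exact isInitial_of_forces_bot (l := l) (Quotient.out m).adj w

theorem exists_of_disjoint_cover (m : X ⟶ L.toTopos) {I : Type*} {U : I → L.carrier}
    (hcov : ⊤ ≤ ⨆ i, U i) (hdisj : ∀ i j, i ≠ j → U i ⊓ U j = ⊥) {A : X.carrier}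
    (hA : IsEmpty (IsInitial A)) :
    ∃ (i : I) (A' : X.carrier), IsEmpty (IsInitial A') ∧ Nonempty (A' ⟶ A) ∧
      Forces m (U i) A' := by
  obtain ⟨_⟩ := X.nonempty_monoidalClosed
  let l : Sheaf (frameTopology L.carrier) (Type u) ⥤ X.carrier := (Quotient.out m).inverse
  have : PreservesFiniteLimits l := (Quotient.out m).leftExact
  exact exists_forces_of_disjoint_cover (l := l) (Quotient.out m).adj hcov hdisj hA

end Forces

end RingedTopos

/-! ### Idempotents of a ring and disjoint opens of spectra -/

/-- The ring homomorphism from a product of copies of `ℤ` given by a complete family of orthogonal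
idempotents. -/
def CompleteOrthogonalIdempotents.piIntHom {R I : Type*} [Ring R] [Fintype I] {e : I → R}
    (he : CompleteOrthogonalIdempotents e) : (I → ℤ) →+* R where
  toFun x := ∑ i, x i • e i
  map_one' := by simpa using he.complete
  map_mul' x y := by
    classical
    simp only [Finset.sum_mul_sum, smul_mul_smul_comm, he.mul_eq]
    simp
  map_zero' := by simp
  map_add' x y := by simp [add_smul, Finset.sum_add_distrib]

theorem CompleteOrthogonalIdempotents.piIntHom_single {R I : Type*} [Ring R] [Fintype I]
    [DecidableEq I] {e : I → R} (he : CompleteOrthogonalIdempotents e) (i : I) :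
    he.piIntHom (Pi.single i 1) = e i := by
  change ∑ j, (Pi.single i 1 : I → ℤ) j • e j = e i
  simp [Pi.single_apply]

theorem OrthogonalTriple.completeOrthogonalIdempotents {R : Type*} [Ring R] {p q r : R}
    (h : OrthogonalTriple p q r) : CompleteOrthogonalIdempotents ![p, q, r] := by
  obtain ⟨ip, iq, ir⟩ := h.idempotent
  obtain ⟨⟨h1, h2⟩, ⟨h3, h4⟩, ⟨h5, h6⟩, h⟩ := h
  refine ⟨⟨fun i => ?_, fun i j hij => ?_⟩, ?_⟩
  · fin_cases i <;> simpa [IsIdempotentElem]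
  · fin_cases i <;> fin_cases j <;> simp_all
  · simpa [Fin.sum_univ_three] using h

section Spectrum

variable {G : RingCat.{0}ᵒᵖ ⥤ RingedTopos.{0}}
  (η : (forget₂ CommRingCat.{0} RingCat.{0}).op ⋙ G ≅ Spec.toRingedTopos) {R : RingCat.{0}}

/-- The morphism to the spectrum of `B` induced by a ring homomorphism from `B`. -/
noncomputable def toSpec (B : CommRingCat.{0}) (φ : (forget₂ CommRingCat RingCat).obj B ⟶ R) :
    G.obj (op R) ⟶ (Spec.toRingedLocale.obj (op B)).toTopos :=
  G.map φ.op ≫ η.hom.app (op B)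

theorem toSpec_naturality {A B : CommRingCat.{0}} (ψ : A ⟶ B)
    (φ : (forget₂ CommRingCat RingCat).obj B ⟶ R) :
    toSpec η B φ ≫ RingedLocale.toRingedTopos.map (Spec.toRingedLocale.map ψ.op) =
      toSpec η A ((forget₂ CommRingCat RingCat).map ψ ≫ φ) := by
  have h := η.hom.naturality ψ.op
  refine (Category.assoc _ _ _).trans ((congrArg (G.map φ.op ≫ ·) h.symm).trans ?_)
  exact (Category.assoc _ _ _).symm.trans
    (congrArg (· ≫ η.hom.app (op A)) (G.map_comp φ.op _).symm)

/-- The basic open of the spectrum, as an element of the frame of opens. -/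
abbrev basicOpenElement {B : CommRingCat.{0}} (b : B) :
    (Spec.toRingedLocale.obj (op B)).carrier :=
  (PrimeSpectrum.basicOpen b : TopologicalSpace.Opens (PrimeSpectrum B))

/-- The homomorphism from the integral polynomial ring given by an element of a ring. -/
noncomputable def evalHom (p : R) :
    (forget₂ CommRingCat RingCat).obj (CommRingCat.of (Polynomial ℤ)) ⟶ R :=
  RingCat.ofHom (Polynomial.aeval p).toRingHom

/-- `A` lies over the open part where `p` is nonzero. -/
def ForcesElement (p : R) (A : (G.obj (op R)).carrier) : Prop :=
  RingedTopos.Forces (toSpec η (CommRingCat.of (Polynomial ℤ)) (evalHom p))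
    (basicOpenElement (B := CommRingCat.of (Polynomial ℤ)) (Polynomial.X : Polynomial ℤ)) A

/-- This is noncontextuality: evaluation at `φ b` factors as `ℤ[X] → B → R`, and `D(X)` pulls back
to `D(b)`. Hence the open attached to an element can be computed in any commutative ring mapping to
`R` that hits it. -/
theorem forcesElement_iff {B : CommRingCat.{0}} (φ : (forget₂ CommRingCat RingCat).obj B ⟶ R)
    (b : B) (A : (G.obj (op R)).carrier) :
    ForcesElement η (φ.hom b) A ↔ RingedTopos.Forces (toSpec η B φ) (basicOpenElement b) A := by
  let ψ : CommRingCat.of (Polynomial ℤ) ⟶ B := CommRingCat.ofHom (Polynomial.aeval b).toRingHom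
  have h : evalHom (R := R) (φ.hom b) = (forget₂ CommRingCat RingCat).map ψ ≫ φ := by
    refine RingCat.hom_ext (Polynomial.ringHom_ext' (Subsingleton.elim _ _) ?_)
    change Polynomial.aeval (R := ℤ) (φ.hom b) Polynomial.X =
      φ.hom (Polynomial.aeval (R := ℤ) b Polynomial.X)
    simp only [Polynomial.aeval_X]
  have hU : (Locale.inverseImage (Spec.toRingedLocale.map ψ.op).base).obj
      (basicOpenElement (B := CommRingCat.of (Polynomial ℤ)) (Polynomial.X : Polynomial ℤ)) =
        basicOpenElement b := by
    refine (PrimeSpectrum.comap_basicOpen ψ.hom _).trans (congrArg PrimeSpectrum.basicOpen ?_)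
    exact Polynomial.aeval_X b
  rw [ForcesElement, h, ← toSpec_naturality, ← hU]
  exact RingedTopos.Forces.comp_iff (toSpec η B φ) (Spec.toRingedLocale.map ψ.op) _ A

theorem basicOpenElement_single_disjoint {I : Type} [DecidableEq I] {i j : I} (hij : i ≠ j) :
    basicOpenElement (B := CommRingCat.of (I → ℤ)) (Pi.single i 1 : I → ℤ) ⊓
      basicOpenElement (B := CommRingCat.of (I → ℤ)) (Pi.single j 1 : I → ℤ) = ⊥ := by
  refine (PrimeSpectrum.basicOpen_mul (R := I → ℤ) (Pi.single i 1) (Pi.single j 1)).symm.trans ?_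
  have h : (Pi.single i 1 * Pi.single j 1 : I → ℤ) = 0 := by
    ext k
    by_cases hk : k = i <;> simp_all [Pi.single_apply]
  rw [h]
  exact PrimeSpectrum.basicOpen_zero

theorem top_le_iSup_basicOpenElement_single {I : Type} [Fintype I] [DecidableEq I] :
    ⊤ ≤ ⨆ i : I, basicOpenElement (B := CommRingCat.of (I → ℤ)) (Pi.single i 1 : I → ℤ) := by
  refine top_le_iff.2 ((PrimeSpectrum.iSup_basicOpen_eq_top_iff (R := I → ℤ)).2 ?_)
  rw [Ideal.eq_top_iff_one, ← Finset.univ_sum_single (1 : I → ℤ)]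
  exact Ideal.sum_mem _ fun i _ => Ideal.subset_span ⟨i, rfl⟩

theorem ForcesElement.disjoint {I : Type} [Fintype I] {e : I → R}
    (he : CompleteOrthogonalIdempotents e) {i j : I} (hij : i ≠ j) {A : (G.obj (op R)).carrier}
    (hi : ForcesElement η (e i) A) (hj : ForcesElement η (e j) A) :
    Nonempty (IsInitial A) := by
  classical
  let φ : (forget₂ CommRingCat RingCat).obj (CommRingCat.of (I → ℤ)) ⟶ R :=
    RingCat.ofHom he.piIntHom
  rw [← he.piIntHom_single] at hi hj
  exact RingedTopos.Forces.disjoint (basicOpenElement_single_disjoint hij)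
    ((forcesElement_iff η φ _ A).1 hi) ((forcesElement_iff η φ _ A).1 hj)

theorem exists_forcesElement {I : Type} [Fintype I] {e : I → R}
    (he : CompleteOrthogonalIdempotents e) {A : (G.obj (op R)).carrier}
    (hA : IsEmpty (IsInitial A)) :
    ∃ (i : I) (A' : (G.obj (op R)).carrier), IsEmpty (IsInitial A') ∧ Nonempty (A' ⟶ A) ∧
      ForcesElement η (e i) A' := by
  classical
  let φ : (forget₂ CommRingCat RingCat).obj (CommRingCat.of (I → ℤ)) ⟶ R :=
    RingCat.ofHom he.piIntHom
  obtain ⟨i, A', h, s, hi⟩ := RingedTopos.Forces.exists_of_disjoint_cover (toSpec η _ φ)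
    top_le_iSup_basicOpenElement_single (fun _ _ => basicOpenElement_single_disjoint) hA
  refine ⟨i, A', h, s, ?_⟩
  rw [← he.piIntHom_single]
  exact (forcesElement_iff η φ _ A').2 hi

/-- Triples are treated one at a time; passing to an object over the previous one keeps everything
already forced. -/
theorem exists_forcesElement_finset {A : (G.obj (op R)).carrier} (hA : IsEmpty (IsInitial A))
    (F : Finset {t : R × R × R // OrthogonalTriple t.1 t.2.1 t.2.2}) :
    ∃ A' : (G.obj (op R)).carrier, IsEmpty (IsInitial A') ∧ ∀ t ∈ F,
      ForcesElement η t.1.1 A' ∨ ForcesElement η t.1.2.1 A' ∨ ForcesElement η t.1.2.2 A' := by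
  classical
  induction F using Finset.induction_on with
  | empty => exact ⟨A, hA, by simp⟩
  | insert t F _ ih =>
    obtain ⟨B, hB, h⟩ := ih
    obtain ⟨i, A', hA', ⟨s⟩, hi⟩ :=
      exists_forcesElement η t.2.completeOrthogonalIdempotents hB
    refine ⟨A', hA', fun k hk => ?_⟩
    rcases Finset.mem_insert.1 hk with rfl | hk
    · fin_cases i
      · exact Or.inl hi
      · exact Or.inr (Or.inl hi)
      · exact Or.inr (Or.inr hi)
    · exact (h k hk).imp (·.precomp s) (Or.imp (·.precomp s) (·.precomp s))

end Spectrum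

/-! ### From noninitial objects to colorings, by compactness -/

/-- If the idempotents of `R` have no coloring, then the topos attached to `R` is degenerate. -/
theorem isInitial_of_not_isColoring {G : RingCat.{0}ᵒᵖ ⥤ RingedTopos.{0}}
    (η : (forget₂ CommRingCat.{0} RingCat.{0}).op ⋙ G ≅ Spec.toRingedTopos) {R : RingCat.{0}}
    (hR : ∀ v : R → Prop, ¬ IsColoring v)
    (A : (G.obj (op R)).carrier) : Nonempty (IsInitial A) := by
  classical
  by_contra hA
  choose B hB hF using exists_forcesElement_finset η (not_nonempty_iff.1 hA)
  let 𝒰 := Ultrafilter.of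
    (Filter.atTop : Filter (Finset {t : R × R × R // OrthogonalTriple t.1 t.2.1 t.2.2}))
  -- An element is colored when `B F` forces it for `𝒰`-almost all `F`. Two colored members of a
  -- triple would be forced by a common `B F`, which would then be initial.
  refine hR (fun p => ∀ᶠ F in (𝒰 : Filter _), ForcesElement η p (B F)) fun p q r h => ?_
  have key {i j : Fin 3} (hij : i ≠ j) :
      ¬((∀ᶠ F in (𝒰 : Filter _), ForcesElement η (![p, q, r] i) (B F)) ∧
        ∀ᶠ F in (𝒰 : Filter _), ForcesElement η (![p, q, r] j) (B F)) := fun ⟨hi, hj⟩ => by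
    obtain ⟨F, h1, h2⟩ := (hi.and hj).exists
    exact not_nonempty_iff.2 (hB F)
      (ForcesElement.disjoint η h.completeOrthogonalIdempotents hij h1 h2)
  refine ⟨?_, key (i := 0) (j := 1) (by decide), key (i := 0) (j := 2) (by decide),
    key (i := 1) (j := 2) (by decide)⟩
  -- Almost every `F` contains the given triple, so `B F` forces one of its members; an ultrafilter
  -- distributes over the disjunction.
  rw [← Ultrafilter.eventually_or, ← Ultrafilter.eventually_or]
  refine Ultrafilter.of_le _ ((Filter.eventually_ge_atTop {⟨(p, q, r), h⟩}).mono fun F hle => ?_)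
  exact hF F ⟨(p, q, r), h⟩ (hle (Finset.mem_singleton_self _))

/-! ### Degenerate objects are initial -/

section Degenerate

/-- Every functor to a degenerate category preserves all limits. -/
theorem preservesFiniteLimits_of_degenerate {C E : Type*} [Category* C] [Category* E]
    (hE : ∀ A : E, Nonempty (IsInitial A)) (F : C ⥤ E) : PreservesFiniteLimits F where
  preservesFiniteLimits _ _ _ :=
    { preservesLimit := 
        { preserves := fun _ => ⟨
            { lift := fun s => (hE s.pt).some.to _
              fac := fun s _ => (hE s.pt).some.hom_ext _ _
              uniq := fun s _ _ => (hE s.pt).some.hom_ext _ _ }⟩ } }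

namespace RingedTopos

/-- A ringed topos all of whose objects are initial is initial. -/
theorem isInitial_of_degenerate {X : RingedTopos.{u}}
    (hX : ∀ A : X.carrier, Nonempty (IsInitial A)) : Nonempty (IsInitial X) := by
  have hX' (A B : X.carrier) : Subsingleton (A ⟶ B) :=
    ⟨fun _ _ => (hX A).some.hom_ext _ _⟩
  rw [isInitial_iff_unique]
  intro Y
  let I : X.carrier ⥤ Y.carrier := (Functor.const _).obj (𝟙_ Y.carrier)
  let K : Y.carrier ⥤ X.carrier := (Functor.const _).obj (𝟙_ X.carrier)
  let adj : K ⊣ I := Adjunction.mkOfHomEquiv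
    { homEquiv := fun A B =>
        { toFun := fun _ => toUnit A
          invFun := fun _ => (hX _).some.to B
          left_inv := fun _ => Subsingleton.elim _ _
          right_inv := fun _ => toUnit_unique _ _ }
      homEquiv_naturality_left_symm := fun _ _ => Subsingleton.elim _ _
      homEquiv_naturality_right := fun _ _ => toUnit_unique _ _ }
  let f : Mor X Y :=
    { direct := I
      inverse := K
      adj := adj
      leftExact := preservesFiniteLimits_of_degenerate hX K
      comap := toUnit _
      map_one := fun _ => Subsingleton.elim _ _
      map_add := fun _ _ => Subsingleton.elim _ _
      map_mul := fun _ _ => Subsingleton.elim _ _ }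
  refine ⟨⟨⟨Quotient.mk _ f⟩, ?_⟩⟩
  rintro ⟨g⟩
  -- Adjunction turns maps into `g.direct.obj B` into maps of the degenerate topos. Every direct
  -- image is thus terminal, which determines `g` up to isomorphism.
  have hg (B : X.carrier) (A : Y.carrier) : Subsingleton (A ⟶ g.direct.obj B) :=
    (g.adj.homEquiv A B).symm.subsingleton
  refine Quotient.sound ⟨NatIso.ofComponents (fun B =>
    { hom := toUnit _
      inv := g.adj.homEquiv _ _ ((hX _).some.to B)
      hom_inv_id := Subsingleton.elim _ _
      inv_hom_id := toUnit_unique _ _ }) (fun _ => toUnit_unique _ _), toUnit_unique _ _⟩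

end RingedTopos

namespace RingedLocale

/-- An initial sheaf of `⊤` maps to the sheaf of `⊥`, and by Yoneda such a map is the inequality `⊤
≤ ⊥`. -/
theorem top_eq_bot_of_degenerate {X : RingedLocale.{u}}
    (hX : ∀ A : X.toTopos.carrier, Nonempty (IsInitial A)) : (⊤ : X.carrier) = ⊥ := by
  obtain ⟨h⟩ := hX (openSheaf (⊤ : X.carrier))
  let f : openSheaf (⊤ : X.carrier) ⟶ openSheaf (⊥ : X.carrier) := h.to _
  exact le_bot_iff.1 ((frameTopology X.carrier).yonedaEquiv f : (⊤ : X.carrier) ⟶ ⊥).le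

theorem subsingleton_sections {X : RingedLocale.{u}} (hX : (⊤ : X.carrier) = ⊥)
    (U : X.carrierᵒᵖ) : Subsingleton (X.presheaf.obj U) := by
  have hsub : Subsingleton X.carrier := subsingleton_of_bot_eq_top hX.symm
  obtain ⟨_⟩ := X.valueSheaf.property.unique_of_eq_bot (U := unop U) (Subsingleton.elim _ _)
  exact inferInstanceAs (Subsingleton (X.valueSheaf.obj.obj U))

end RingedLocale

/-- A ring with at most one element is terminal. -/
theorem CommRingCat.nonempty_unique_hom_of_subsingleton (A B : CommRingCat.{u}) [Subsingleton B] :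
    Nonempty (Unique (A ⟶ B)) :=
  ⟨⟨⟨CommRingCat.ofHom
    { toFun := fun _ => 0
      map_one' := Subsingleton.elim _ _
      map_mul' := fun _ _ => Subsingleton.elim _ _
      map_zero' := rfl
      map_add' := fun _ _ => Subsingleton.elim _ _ }⟩,
    fun _ => CommRingCat.hom_ext (RingHom.ext fun _ => Subsingleton.elim _ _)⟩⟩

/-- A presheaf of zero rings is terminal. -/
theorem nonempty_unique_natTrans_of_subsingleton {C : Type*} [Category* C]
    (F K : C ⥤ CommRingCat.{u}) (hK : ∀ U, Subsingleton (K.obj U)) : Nonempty (Unique (F ⟶ K)) := by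
  have h (A : CommRingCat.{u}) (U : C) : Unique (A ⟶ K.obj U) :=
    have := hK U
    (CommRingCat.nonempty_unique_hom_of_subsingleton A _).some
  exact ⟨⟨⟨⟨fun U => (h (F.obj U) U).default,
    fun _ V _ => (h _ V).instSubsingleton.elim _ _⟩⟩,
    fun f => NatTrans.ext (funext fun U => (h (F.obj U) U).instSubsingleton.elim _ _)⟩⟩

/-- A ringed locale whose underlying locale is trivial is initial. -/
theorem RingedLocale.isInitial_of_top_eq_bot {X : RingedLocale.{u}} (hX : (⊤ : X.carrier) = ⊥) :
    Nonempty (IsInitial X) := by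
  have hsub : Subsingleton X.carrier := subsingleton_of_bot_eq_top hX.symm
  rw [isInitial_iff_unique]
  intro Y
  let b : X.carrier ⟶ Y.carrier := (Frm.ofHom
    { toFun := fun _ => ⊤
      map_inf' := fun _ _ => Subsingleton.elim _ _
      map_top' := rfl
      map_sSup' := fun _ => Subsingleton.elim _ _ }).op
  have hb (b' : X.carrier ⟶ Y.carrier) : b' = b :=
    Quiver.Hom.unop_inj (Frm.hom_ext (FrameHom.ext fun _ => Subsingleton.elim _ _))
  obtain ⟨hc⟩ := nonempty_unique_natTrans_of_subsingleton Y.presheaf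
    ((Locale.inverseImage b).op ⋙ X.presheaf) fun U => subsingleton_sections hX _
  refine ⟨⟨⟨⟨b, hc.default⟩⟩, ?_⟩⟩
  rintro ⟨b', c'⟩
  obtain rfl := hb b'
  exact RingedLocale.Hom.ext rfl (heq_of_eq (hc.uniq c'))

/-- A ringed space whose underlying space is empty is initial. -/
theorem AlgebraicGeometry.RingedSpace.isInitial_of_top_eq_bot {X : RingedSpace.{u, u}}
    (hX : (⊤ : TopologicalSpace.Opens X.carrier) = ⊥) : Nonempty (IsInitial X) := by
  have hemp : IsEmpty X.carrier := ⟨fun x => by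
    have : x ∈ (⊤ : TopologicalSpace.Opens X.carrier) := trivial
    rw [hX] at this
    exact this⟩
  rw [isInitial_iff_unique]
  intro Y
  let b : X.carrier ⟶ Y.carrier := TopCat.ofHom ⟨isEmptyElim, continuous_of_const fun x => hemp.elim x⟩
  have hb (b' : X.carrier ⟶ Y.carrier) : b' = b := by
    ext x
    exact hemp.elim x
  obtain ⟨hc⟩ := nonempty_unique_natTrans_of_subsingleton Y.presheaf
    ((TopCat.Presheaf.pushforward _ b).obj X.presheaf) fun U =>
      RingedLocale.subsingleton_sections (X := RingedSpace.toRingedLocale.obj X) hX _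
  refine ⟨⟨⟨⟨⟨b, hc.default⟩⟩⟩, ?_⟩⟩
  rintro ⟨⟨b', c'⟩⟩
  obtain rfl := hb b'
  rw [hc.uniq c']
  rfl

end Degenerate

/-! ### The three target categories -/

theorem mainTheorem7 (n : ℕ) (hn : 3 ≤ n) :
    (∀ G : RingCat.{0}ᵒᵖ ⥤ RingedTopos.{0},
      Nonempty ((forget₂ CommRingCat.{0} RingCat.{0}).op ⋙ G ≅ Spec.toRingedTopos) →
      Nonempty (IsInitial (G.obj (op (RingCat.of (Matrix (Fin n) (Fin n) ℂ)))))) ∧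
    (∀ G : RingCat.{0}ᵒᵖ ⥤ RingedSpace.{0, 0},
      Nonempty ((forget₂ CommRingCat.{0} RingCat.{0}).op ⋙ G ≅ Spec.toSheafedSpace) →
      Nonempty (IsInitial (G.obj (op (RingCat.of (Matrix (Fin n) (Fin n) ℂ)))))) ∧
    (∀ G : RingCat.{0}ᵒᵖ ⥤ RingedLocale.{0},
      Nonempty ((forget₂ CommRingCat.{0} RingCat.{0}).op ⋙ G ≅ Spec.toRingedLocale) →
      Nonempty (IsInitial (G.obj (op (RingCat.of (Matrix (Fin n) (Fin n) ℂ)))))) := by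
  have topos (G : RingCat.{0}ᵒᵖ ⥤ RingedTopos.{0})
      (η : (forget₂ CommRingCat.{0} RingCat.{0}).op ⋙ G ≅ Spec.toRingedTopos) :=
    isInitial_of_not_isColoring η (R := RingCat.of (Matrix (Fin n) (Fin n) ℂ))
      (not_isColoring_matrix hn)
  -- Composing `G` with the functor to ringed toposes yields an extension of the topos-valued
  -- spectrum, to which the topos case applies. Ringed spaces are reduced to locales in the same
  -- way.
  have locale (G : RingCat.{0}ᵒᵖ ⥤ RingedLocale.{0})
      (η : (forget₂ CommRingCat.{0} RingCat.{0}).op ⋙ G ≅ Spec.toRingedLocale) :=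
    RingedLocale.top_eq_bot_of_degenerate (topos (G ⋙ RingedLocale.toRingedTopos)
      (Functor.isoWhiskerRight η RingedLocale.toRingedTopos))
  refine ⟨fun G ⟨η⟩ => RingedTopos.isInitial_of_degenerate (topos G η), fun G ⟨η⟩ => ?_,
    fun G ⟨η⟩ => RingedLocale.isInitial_of_top_eq_bot (locale G η)⟩
  exact RingedSpace.isInitial_of_top_eq_bot (locale (G ⋙ RingedSpace.toRingedLocale)
    (Functor.isoWhiskerRight η RingedSpace.toRingedLocale))
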